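/- Let $m,n\ge 1$, let $A$ be a complex $m\times m$ matrix and let $z_1,\dots,z_n\in\mathbb C$ be arbitrary, possibly repeated, points. Let $p$ be the interpolation polynomial of the function $f(z)=e^z$ at the points $z_1,\dots,z_n$, taking multiplicities into account; that is, $p$ is the polynomial of degree at most $n-1$ such that $p^{(j)}(w)=f^{(j)}(w)$ for $0\le j<r$ whenever the point $w$ occurs exactly $r\geq 1$ times among $z_1,\dots,z_n$. Put $$\Omega(z)=\prod_{k=1}^n(z-z_k),\qquad \gamma=\max\Bigl\{\max_{\lambda\in\sigma(A)}\operatorname{Re}\lambda,\ \max_{1\le k\le n}\operatorname{Re}z_k\Bigr\},$$ where $\sigma(A)$ is the spectrum of $A$, and let $\|\cdot\|_{2\to2}$ be the matrix norm induced by the Euclidean norm on $\mathbb C^m$. Then $$\|e^A-p(A)\|_{2\to2}\le e^{\gamma}\,\frac{\|\Omega(A)\|_{2\to2}}{n!}\sum_{j=0}^{m-1}\frac{(2\|A\|_{2\to2})^j}{j!}.$$ -/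

import Mathlib

open scoped Matrix.Norms.L2Operator

/-- The polynomial `Ω(X) = ∏ₖ (X - zₖ)` of a family of (possibly repeated) points. -/
noncomputable def nodePolynomial {n : ℕ} (z : Fin n → ℂ) : Polynomial ℂ :=
  ∏ k : Fin n, (Polynomial.X - Polynomial.C (z k))

/-- `p` is the (Hermite) interpolation polynomial of `f` at the points `z₁, …, zₙ`, taking
multiplicities into account: `p` has degree less than `n`, and at every point `w` that occurs `r`
times among the `zₖ`, the derivatives of `p` and `f` of the orders `0, …, r - 1` agree. -/
def IsInterpolationPolynomial {n : ℕ} (f : ℂ → ℂ) (z : Fin n → ℂ) (p : Polynomial ℂ) : Prop :=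
  p.degree < n ∧
    ∀ (w : ℂ) (j : ℕ), j < Nat.card {k : Fin n // z k = w} →
      (Polynomial.derivative^[j] p).eval w = iteratedDeriv j f w

/-- The spectral abscissa `max {Re λ : λ ∈ σ(A)}` of a (nonempty) square complex matrix; the
supremum is over a finite nonempty set, hence a maximum. -/
noncomputable def spectralAbscissa {m : ℕ} (A : Matrix (Fin m) (Fin m) ℂ) : ℝ :=
  sSup (Complex.re '' spectrum ℂ A)

/-- `max_k Re zₖ`, for a nonempty finite family of points. -/
noncomputable def maxRe {n : ℕ} (z : Fin n → ℂ) : ℝ :=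
  ⨆ k : Fin n, (z k).re

/-! Newton's formula gives e^{tA} = P(A) + Ω(A) g(t), with P the Newton interpolant of e^{tζ} at the
nodes and g the divided difference with A as one argument (`exp_eq_aeval_expNewtonPolynomial_add`).
Adding a node w to g means solving y' = wy + g, y(0) = 0; so if ‖e^{tA}‖ ≤ C e^{tγ} and all nodes
have real part at most γ, n iterated integrations give ‖g(t)‖ ≤ C e^{tγ} tⁿ/n!
(`norm_expDividedDifference_le`).

The formula is used twice. With the eigenvalues of A as nodes, Cayley–Hamilton kills the remainder,
and bounding the Newton form yields C (`Matrix.norm_exp_smul_le`). With the given nodes and t = 1, P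
= p by uniqueness, and the remainder is the error. -/

/-- `expDividedDifference A L t` is the divided difference of `ζ ↦ exp (t ζ)` at the nodes `L` and
the element `A` of a complex Banach algebra. -/
noncomputable def expDividedDifference {𝔸 : Type*} [NormedRing 𝔸] [NormedAlgebra ℂ 𝔸] (A : 𝔸) :
    List ℂ → ℝ → 𝔸
  | [], t => NormedSpace.exp ((t : ℂ) • A)
  | w :: L, t => Complex.exp (t * w) •
      ∫ s in (0 : ℝ)..t, Complex.exp (-(s * w)) • expDividedDifference A L s

/-! ### Divided differences of the exponential as iterated integrals -/

section DividedDifference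

variable {𝔸 : Type*} [NormedRing 𝔸] [NormedAlgebra ℂ 𝔸]

theorem hasDerivAt_cexp_ofReal_mul (w : ℂ) (t : ℝ) :
    HasDerivAt (fun s : ℝ => Complex.exp (s * w)) (Complex.exp (t * w) * w) t := by
  have h : HasDerivAt (fun s : ℂ => Complex.exp (s * w)) (Complex.exp (t * w) * w) t := by
    simpa using ((hasDerivAt_id (t : ℂ)).mul_const w).cexp
  exact h.comp_ofReal

theorem hasDerivAt_cexp_neg_ofReal_mul (w : ℂ) (t : ℝ) :
    HasDerivAt (fun s : ℝ => Complex.exp (-(s * w))) (-(Complex.exp (-(t * w)) * w)) t := by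
  simpa using hasDerivAt_cexp_ofReal_mul (-w) t

theorem expDividedDifference_zero (A : 𝔸) (L : List ℂ) (w : ℂ) :
    expDividedDifference A L 0 = algebraMap ℂ 𝔸 (expDividedDifference w L 0) := by
  cases L <;> simp [expDividedDifference]

theorem norm_expDividedDifference_le (A : 𝔸) {C γ T : ℝ}
    (hA : ∀ t, 0 ≤ t → t ≤ T → ‖NormedSpace.exp ((t : ℂ) • A)‖ ≤ C * Real.exp (t * γ))
    (L : List ℂ) (hL : ∀ w ∈ L, w.re ≤ γ) {t : ℝ} (ht0 : 0 ≤ t) (htT : t ≤ T) :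
    ‖expDividedDifference A L t‖ ≤
      C * Real.exp (t * γ) * (t ^ L.length / (L.length.factorial : ℝ)) := by
  induction L generalizing t with
  | nil => simpa [expDividedDifference] using hA t ht0 htT
  | cons w L ih =>
    have hw : w.re ≤ γ := hL w (by simp)
    have hbound : ∀ s ∈ Set.Ioc 0 t,
        ‖Complex.exp (t * w) • Complex.exp (-(s * w)) • expDividedDifference A L s‖ ≤
          C * Real.exp (t * γ) * (s ^ L.length / (L.length.factorial : ℝ)) := by
      intro s hs
      have h1 := ih (fun v hv => hL v (by simp [hv])) hs.1.le (hs.2.trans htT)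
      rw [smul_smul, ← Complex.exp_add, norm_smul, Complex.norm_exp]
      have h2 : ((t : ℂ) * w + -(s * w)).re = (t - s) * w.re := by
        simp; ring
      have h3 : (t - s) * w.re ≤ (t - s) * γ :=
        mul_le_mul_of_nonneg_left hw (sub_nonneg.2 hs.2)
      have hs0 := hs.1.le
      calc _ ≤ Real.exp ((t - s) * γ) *
            (C * Real.exp (s * γ) * (s ^ L.length / (L.length.factorial : ℝ))) := by
            rw [h2]; gcongr
        _ = C * (Real.exp ((t - s) * γ) * Real.exp (s * γ)) *
            (s ^ L.length / (L.length.factorial : ℝ)) := by ring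
        _ = _ := by rw [← Real.exp_add]; ring_nf
    have h := intervalIntegral.norm_integral_le_of_norm_le (μ := MeasureTheory.volume) ht0
      (Filter.Eventually.of_forall hbound) (Continuous.intervalIntegrable (by fun_prop) 0 t)
    rw [intervalIntegral.integral_smul] at h
    refine h.trans_eq ?_
    rw [intervalIntegral.integral_const_mul, intervalIntegral.integral_div, integral_pow,
      List.length_cons, Nat.factorial_succ]
    push_cast
    field_simp
    simp

variable [CompleteSpace 𝔸]

theorem hasDerivAt_expDividedDifference_nil (A : 𝔸) (t : ℝ) :
    HasDerivAt (expDividedDifference A []) (A * expDividedDifference A [] t) t := by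
  have h := (hasDerivAt_exp_smul_const' (𝕂 := ℂ) A (t : ℂ)).scomp t
    (Complex.ofRealCLM.hasDerivAt (x := t))
  simpa [expDividedDifference, Function.comp_def] using h

theorem continuous_expDividedDifference (A : 𝔸) (L : List ℂ) :
    Continuous (expDividedDifference A L) := by
  induction L with
  | nil =>
    exact continuous_iff_continuousAt.2 fun t =>
      (hasDerivAt_expDividedDifference_nil A t).continuousAt
  | cons w L ih =>
    have hc : Continuous fun s : ℝ => Complex.exp (-(s * w)) • expDividedDifference A L s := by
      fun_prop
    have hi := intervalIntegral.continuous_primitive (μ := MeasureTheory.volume)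
      (fun a b => hc.intervalIntegrable a b) 0
    simp only [expDividedDifference]
    exact Continuous.smul (by fun_prop) hi

theorem hasDerivAt_expDividedDifference_cons (A : 𝔸) (w : ℂ) (L : List ℂ) (t : ℝ) :
    HasDerivAt (expDividedDifference A (w :: L))
      (w • expDividedDifference A (w :: L) t + expDividedDifference A L t) t := by
  have hc : Continuous fun s : ℝ => Complex.exp (-(s * w)) • expDividedDifference A L s :=
    Continuous.smul (by fun_prop) (continuous_expDividedDifference A L)
  have h := (hasDerivAt_cexp_ofReal_mul w t).smul (hc.integral_hasStrictDerivAt 0 t).hasDerivAt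
  convert! h using 1
  simp only [expDividedDifference, smul_smul, ← Complex.exp_add]
  rw [add_neg_cancel, Complex.exp_zero, one_smul, mul_comm w, add_comm]

/-- In the difference of the two differential equations `c` cancels, so e^{-sw}(X - x) has
derivative (A - w)e^{-sw}X and vanishes at 0; integrate over [0, t]. -/
theorem mul_expDividedDifference_cons_of_hasDerivAt (A : 𝔸) (w : ℂ) (L : List ℂ) (c : ℝ → ℂ)
    (hA : ∀ t, HasDerivAt (expDividedDifference A L)
      (A * expDividedDifference A L t + algebraMap ℂ 𝔸 (c t)) t)
    (hw : ∀ t, HasDerivAt (expDividedDifference w L) (w * expDividedDifference w L t + c t) t)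
    (t : ℝ) :
    A * expDividedDifference A (w :: L) t = w • expDividedDifference A (w :: L) t +
      expDividedDifference A L t - algebraMap ℂ 𝔸 (expDividedDifference w L t) := by
  set X : ℝ → 𝔸 := expDividedDifference A L with hX
  set x : ℝ → ℂ := expDividedDifference w L with hx
  have hcX : Continuous X := continuous_expDividedDifference A L
  have hce : Continuous fun s : ℝ => Complex.exp (-(s * w)) := by fun_prop
  have hderiv : ∀ s : ℝ, HasDerivAt
      (fun s : ℝ => Complex.exp (-(s * w)) • (X s - algebraMap ℂ 𝔸 (x s)))
      (A * (Complex.exp (-(s * w)) • X s) - w • (Complex.exp (-(s * w)) • X s)) s := by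
    intro s
    have hx' : HasDerivAt (fun s => algebraMap ℂ 𝔸 (x s)) (algebraMap ℂ 𝔸 (w * x s + c s)) s := by
      have := (hw s).smul_const (1 : 𝔸)
      simpa only [Algebra.algebraMap_eq_smul_one] using this
    have h := (hasDerivAt_cexp_neg_ofReal_mul w s).smul ((hA s).sub hx')
    convert! h using 1
    simp only [Algebra.algebraMap_eq_smul_one, mul_smul_comm, Pi.sub_apply]
    module
  have hint := intervalIntegral.integral_eq_sub_of_hasDerivAt (a := 0) (b := t)
    (fun s _ => hderiv s) (Continuous.intervalIntegrable
      ((continuous_const.mul (hce.smul hcX)).sub ((hce.smul hcX).const_smul w)) 0 t)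
  have hsub := intervalIntegral.integral_sub (μ := MeasureTheory.volume)
    (f := fun s : ℝ => A * (Complex.exp (-(s * w)) • X s))
    (g := fun s : ℝ => w • (Complex.exp (-(s * w)) • X s))
    ((continuous_const.mul (hce.smul hcX)).intervalIntegrable 0 t)
    (((hce.smul hcX).const_smul w).intervalIntegrable 0 t)
  rw [hsub, intervalIntegral.integral_smul] at hint
  have hmul : ∫ s in (0 : ℝ)..t, A * (Complex.exp (-(s * w)) • X s) =
      A * ∫ s in (0 : ℝ)..t, Complex.exp (-(s * w)) • X s :=
    (ContinuousLinearMap.mul ℂ 𝔸 A).intervalIntegral_comp_comm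
      ((hce.smul hcX).intervalIntegrable 0 t)
  rw [hmul, hX, hx, expDividedDifference_zero A L w, sub_self, smul_zero, sub_zero, ← hX, ← hx]
    at hint
  have := congrArg (fun y => Complex.exp (t * w) • y) hint
  simp only [smul_smul, ← Complex.exp_add, add_neg_cancel, Complex.exp_zero, one_smul, smul_sub]
    at this
  simp only [expDividedDifference, mul_smul_comm, ← hX]
  rw [smul_comm w, add_sub_assoc, ← this, smul_smul]
  abel

/-- The forcing term `c` depends on `L` alone, not on `A` or `w`; this is what lets the Newton
recursion and the differential equation be proved together by induction. -/
theorem exists_hasDerivAt_expDividedDifference (L : List ℂ) :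
    ∃ c : ℝ → ℂ, (∀ (A : 𝔸) (t : ℝ), HasDerivAt (expDividedDifference A L)
        (A * expDividedDifference A L t + algebraMap ℂ 𝔸 (c t)) t) ∧
      ∀ (w : ℂ) (t : ℝ), HasDerivAt (expDividedDifference w L)
        (w * expDividedDifference w L t + c t) t := by
  induction L with
  | nil =>
    exact ⟨0, fun A t => by simpa using hasDerivAt_expDividedDifference_nil A t,
      fun w t => by simpa using hasDerivAt_expDividedDifference_nil w t⟩
  | cons v L ih =>
    obtain ⟨c, hA, hw⟩ := ih
    refine ⟨expDividedDifference v L, fun A t => ?_, fun w t => ?_⟩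
    · convert hasDerivAt_expDividedDifference_cons A v L t using 1
      rw [mul_expDividedDifference_cons_of_hasDerivAt A v L c (hA A) (hw v)]
      abel
    · have h := hasDerivAt_expDividedDifference_cons w v L t
      rwa [show v • expDividedDifference w (v :: L) t + expDividedDifference w L t =
          w * expDividedDifference w (v :: L) t + expDividedDifference v L t by
        rw [mul_expDividedDifference_cons_of_hasDerivAt w v L c (hw w) (hw v)]
        simp] at h

theorem mul_expDividedDifference_cons (A : 𝔸) (w : ℂ) (L : List ℂ) (t : ℝ) :
    A * expDividedDifference A (w :: L) t = w • expDividedDifference A (w :: L) t +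
      expDividedDifference A L t - algebraMap ℂ 𝔸 (expDividedDifference w L t) := by
  obtain ⟨c, hA, hw⟩ := exists_hasDerivAt_expDividedDifference (𝔸 := 𝔸) L
  exact mul_expDividedDifference_cons_of_hasDerivAt A w L c (hA A) (hw w) t

theorem norm_expDividedDifference_complex_le {w : ℂ} {γ : ℝ} (hw : w.re ≤ γ)
    (L : List ℂ) (hL : ∀ v ∈ L, v.re ≤ γ) {t : ℝ} (ht : 0 ≤ t) :
    ‖expDividedDifference w L t‖ ≤
      Real.exp (t * γ) * (t ^ L.length / (L.length.factorial : ℝ)) := by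
  have h := norm_expDividedDifference_le w (C := 1) (γ := γ) (T := t)
    (fun s hs _ => by
      rw [← Complex.exp_eq_exp_ℂ, Complex.norm_exp, one_mul]
      simpa using mul_le_mul_of_nonneg_left hw hs) L hL ht le_rfl
  simpa using h

end DividedDifference

/-! ### Newton's interpolation formula and bounds for its terms -/

section NewtonPolynomial

open Polynomial

/-- The Newton form of the interpolation polynomial of `ζ ↦ exp (t ζ)` at the nodes `L`. -/
noncomputable def expNewtonPolynomial (t : ℝ) : List ℂ → ℂ[X]
  | [] => 0
  | w :: L => expNewtonPolynomial t L +
      C (expDividedDifference w L t) * (L.map fun v => X - C v).prod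

theorem degree_expNewtonPolynomial_lt (t : ℝ) (L : List ℂ) :
    (expNewtonPolynomial t L).degree < L.length := by
  induction L with
  | nil => simp [expNewtonPolynomial]
  | cons w L ih =>
    have hprod : ((L.map fun v => X - C v).prod : ℂ[X]).degree ≤ L.length := by
      refine (degree_list_prod_le _).trans ?_
      simp [List.map_map, Function.comp_def]
    have hlt : (L.length : WithBot ℕ) < (w :: L).length := by
      exact_mod_cast Nat.lt_succ_self L.length
    refine (degree_add_le _ _).trans_lt (max_lt (ih.trans hlt) (lt_of_le_of_lt ?_ hlt))
    rw [← smul_eq_C_mul]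
    exact (degree_smul_le _ _).trans hprod

variable {𝔸 : Type*} [NormedRing 𝔸] [NormedAlgebra ℂ 𝔸]

theorem norm_aeval_prod_X_sub_C_le [NormOneClass 𝔸] (A : 𝔸) {r : ℝ} (hr : 0 ≤ r) (L : List ℂ)
    (hL : ∀ w ∈ L, ‖A - algebraMap ℂ 𝔸 w‖ ≤ r) :
    ‖aeval A (L.map fun v => X - C v).prod‖ ≤ r ^ L.length := by
  induction L with
  | nil => simp
  | cons w L ih =>
    rw [List.map_cons, List.prod_cons, map_mul, List.length_cons, pow_succ']
    refine (norm_mul_le _ _).trans (mul_le_mul ?_ (ih fun v hv => hL v (by simp [hv]))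
      (norm_nonneg _) hr)
    simpa using hL w (by simp)

theorem norm_aeval_expNewtonPolynomial_le [NormOneClass 𝔸] (A : 𝔸) {r γ t : ℝ} (hr : 0 ≤ r)
    (ht : 0 ≤ t) (L : List ℂ) (hL : ∀ w ∈ L, ‖A - algebraMap ℂ 𝔸 w‖ ≤ r)
    (hγ : ∀ w ∈ L, w.re ≤ γ) :
    ‖aeval A (expNewtonPolynomial t L)‖ ≤
      Real.exp (t * γ) * ∑ j ∈ Finset.range L.length, (t * r) ^ j / (j.factorial : ℝ) := by
  induction L with
  | nil => simp [expNewtonPolynomial]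
  | cons w L ih =>
    have hL' : ∀ v ∈ L, ‖A - algebraMap ℂ 𝔸 v‖ ≤ r := fun v hv => hL v (by simp [hv])
    have hγ' : ∀ v ∈ L, v.re ≤ γ := fun v hv => hγ v (by simp [hv])
    simp only [expNewtonPolynomial, map_add, map_mul, aeval_C, ← Algebra.smul_def]
    rw [List.length_cons, Finset.sum_range_succ, mul_add]
    refine (norm_add_le _ _).trans (add_le_add (ih hL' hγ') ?_)
    rw [norm_smul]
    refine (mul_le_mul (norm_expDividedDifference_complex_le (hγ w (by simp)) L hγ' ht)
      (norm_aeval_prod_X_sub_C_le A hr L hL') (norm_nonneg _) (by positivity)).trans_eq ?_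
    rw [mul_pow]
    ring

variable [CompleteSpace 𝔸]

theorem exp_eq_aeval_expNewtonPolynomial_add (A : 𝔸) (t : ℝ) (L : List ℂ) :
    NormedSpace.exp ((t : ℂ) • A) = aeval A (expNewtonPolynomial t L) +
      aeval A (L.map fun v => X - C v).prod * expDividedDifference A L t := by
  induction L with
  | nil => simp [expNewtonPolynomial, expDividedDifference]
  | cons w L ih =>
    have h := mul_expDividedDifference_cons A w L t
    have h' : (A - algebraMap ℂ 𝔸 w) * expDividedDifference A (w :: L) t =
        expDividedDifference A L t - algebraMap ℂ 𝔸 (expDividedDifference w L t) := by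
      rw [sub_mul, h, ← Algebra.smul_def]; abel
    rw [ih, List.map_cons, List.prod_cons, mul_comm (X - C w)]
    simp only [expNewtonPolynomial, map_add, map_mul, map_sub, aeval_X, aeval_C]
    rw [mul_assoc, h', mul_sub, Algebra.commutes]
    abel

end NewtonPolynomial

/-! ### Uniqueness of Hermite interpolation -/

section Interpolation

open Polynomial Filter Topology

theorem Polynomial.pow_X_sub_C_dvd_of_isBigO {D : ℂ[X]} {w : ℂ} {r : ℕ}
    (h : (fun ζ => D.eval ζ) =O[𝓝 w] fun ζ => (ζ - w) ^ r) : (X - C w) ^ r ∣ D := by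
  by_cases hD : D = 0
  · simp [hD]
  obtain ⟨q, hq, hndvd⟩ := D.exists_eq_pow_rootMultiplicity_mul_and_not_dvd hD w
  set k := D.rootMultiplicity w
  by_contra hdvd
  have hk : k < r := by
    by_contra! hk
    exact hdvd ((pow_dvd_pow _ hk).trans (hq ▸ dvd_mul_right _ _))
  refine hndvd (dvd_iff_isRoot.2 ?_)
  obtain ⟨K, hK⟩ := h.bound
  have hle : ∀ᶠ ζ in 𝓝[≠] w, ‖q.eval ζ‖ ≤ K * ‖(ζ - w) ^ (r - k)‖ := by
    filter_upwards [nhdsWithin_le_nhds hK, self_mem_nhdsWithin] with ζ hζ hne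
    have hne' : 0 < ‖(ζ - w) ^ k‖ := norm_pos_iff.2 (pow_ne_zero _ (sub_ne_zero.2 hne))
    rw [hq, ← Nat.add_sub_cancel' hk.le, pow_add] at hζ
    simp only [eval_mul, eval_pow, eval_sub, eval_X, eval_C, norm_mul] at hζ
    refine le_of_mul_le_mul_left (hζ.trans_eq ?_) hne'
    ring
  have hlim : Tendsto (fun ζ : ℂ => K * ‖(ζ - w) ^ (r - k)‖) (𝓝[≠] w) (𝓝 0) := by
    have : Continuous fun ζ : ℂ => K * ‖(ζ - w) ^ (r - k)‖ := by fun_prop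
    have h0 := (this.tendsto w).mono_left (nhdsWithin_le_nhds (s := {w}ᶜ))
    simpa [Nat.sub_ne_zero_of_lt hk] using h0
  have hq0 := (squeeze_zero_norm' hle hlim)
  exact tendsto_nhds_unique ((q.continuous.tendsto w).mono_left nhdsWithin_le_nhds) hq0

theorem Polynomial.iteratedDeriv_eval (p : ℂ[X]) (j : ℕ) :
    iteratedDeriv j (fun ζ => p.eval ζ) = fun ζ => (derivative^[j] p).eval ζ := by
  induction j with
  | zero => simp
  | succ j ih =>
    rw [iteratedDeriv_succ, ih, Function.iterate_succ_apply']
    ext ζ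
    simp

theorem Polynomial.contDiff_eval (p : ℂ[X]) (k : ℕ) : ContDiff ℂ k fun ζ => p.eval ζ := by
  simpa using p.contDiff_aeval (𝕜 := ℂ) k

theorem isBigO_exp_sub_eval {p : ℂ[X]} {w : ℂ} {r : ℕ}
    (h : ∀ j < r, (derivative^[j] p).eval w = iteratedDeriv j Complex.exp w) :
    (fun ζ => Complex.exp ζ - p.eval ζ) =O[𝓝 w] fun ζ => (ζ - w) ^ r := by
  have han : AnalyticAt ℂ (fun ζ => Complex.exp ζ - p.eval ζ) w :=
    (by fun_prop : Differentiable ℂ fun ζ => Complex.exp ζ - p.eval ζ).analyticAt w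
  obtain ⟨g, hg, hgeq⟩ := (natCast_le_analyticOrderAt han (n := r)).1
    ((natCast_le_analyticOrderAt_iff_iteratedDeriv_eq_zero han).2 fun j hj => by
      rw [iteratedDeriv_fun_sub Complex.contDiff_exp.contDiffAt (contDiff_eval p j).contDiffAt,
        p.iteratedDeriv_eval]
      exact sub_eq_zero.2 (h j hj).symm)
  refine Asymptotics.IsBigO.congr' ?_ (EventuallyEq.symm hgeq) EventuallyEq.rfl
  simpa using (Asymptotics.isBigO_refl (fun ζ : ℂ => (ζ - w) ^ r) (𝓝 w)).smul
    (hg.continuousAt.isBigO_one ℂ)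

/-- The norm bound is uniform on half-planes Re ζ ≤ γ, so continuity in ζ is not needed. -/
theorem isBigO_expDividedDifference_one (L : List ℂ) (w : ℂ) :
    (fun ζ : ℂ => expDividedDifference ζ L 1) =O[𝓝 w] fun _ => (1 : ℂ) := by
  -- Including w + 1 makes the half-plane a neighbourhood of w.
  obtain ⟨γ, hγ⟩ : ∃ γ : ℝ, ∀ v ∈ (w + 1) :: L, v.re ≤ γ := by
    obtain ⟨γ, hγ⟩ := (((w + 1) :: L).toFinset.image Complex.re).bddAbove
    exact ⟨γ, fun v hv => hγ (by
      simp only [Finset.coe_image]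
      exact ⟨v, by simpa using hv, rfl⟩)⟩
  have hnear : ∀ᶠ ζ : ℂ in 𝓝 w, ζ.re < (w + 1).re :=
    Complex.continuous_re.continuousAt.eventually_lt continuousAt_const (by simp)
  refine Asymptotics.IsBigO.of_bound (Real.exp (1 * γ) * (1 ^ L.length / (L.length.factorial : ℝ)))
    ?_
  filter_upwards [hnear] with ζ hζ
  simpa using norm_expDividedDifference_complex_le
    (hζ.le.trans (hγ (w + 1) (by simp))) L (fun v hv => hγ v (by simp [hv])) zero_le_one

/-- Both exp - p and exp - P vanish at each node to its multiplicity, so P - p, of degree below n,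
would have n roots. -/
theorem IsInterpolationPolynomial.eq_expNewtonPolynomial {n : ℕ} {z : Fin n → ℂ} {p : ℂ[X]}
    (hp : IsInterpolationPolynomial Complex.exp z p) :
    p = expNewtonPolynomial 1 (List.ofFn z) := by
  classical
  set L := List.ofFn z with hL
  set P := expNewtonPolynomial 1 L
  have hlen : L.length = n := by simp [hL]
  by_contra hne
  have hD : P - p ≠ 0 := sub_ne_zero.2 (Ne.symm hne)
  have hdeg : (P - p).degree < n :=
    (degree_sub_le _ _).trans_lt (max_lt (hlen ▸ degree_expNewtonPolynomial_lt 1 L) hp.1)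
  have hcount : ∀ w, L.count w = Nat.card {k : Fin n // z k = w} := by
    intro w
    rw [Nat.card_eq_fintype_card, Fintype.card_subtype, ← Multiset.coe_count, hL,
      ← Fin.univ_val_map, Multiset.count_map]
    simp only [eq_comm (a := w)]
    rfl
  have hroots : (L : Multiset ℂ) ≤ (P - p).roots := by
    rw [Multiset.le_iff_count]
    intro w
    rw [count_roots, Multiset.coe_count, le_rootMultiplicity_iff hD]
    refine pow_X_sub_C_dvd_of_isBigO ?_
    have h1 := isBigO_exp_sub_eval (hp.2 w)
    rw [← hcount] at h1
    obtain ⟨Q, hQ⟩ : (X - C w) ^ L.count w ∣ (L.map fun v => X - C v).prod := by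
      have : (X - C w) ^ L.count w = ((List.replicate (L.count w) w).map fun v => X - C v).prod := by
        simp
      rw [this]
      exact ((List.replicate_sublist_iff.2 le_rfl).map _).prod_dvd_prod
    have h2 : (fun ζ => Complex.exp ζ - P.eval ζ) =O[𝓝 w] fun ζ => (ζ - w) ^ L.count w := by
      have heq : (fun ζ => Complex.exp ζ - P.eval ζ) = fun ζ =>
          (ζ - w) ^ L.count w * (Q.eval ζ * expDividedDifference ζ L 1) := by
        ext ζ
        have := exp_eq_aeval_expNewtonPolynomial_add ζ 1 L
        rw [hQ] at this
        simp only [Complex.ofReal_one, one_smul, ← Complex.exp_eq_exp_ℂ, coe_aeval_eq_eval,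
          eval_mul, eval_pow, eval_sub, eval_X, eval_C] at this
        rw [this]
        ring
      rw [heq]
      simpa using (Asymptotics.isBigO_refl (fun ζ : ℂ => (ζ - w) ^ L.count w) (𝓝 w)).mul
        ((Q.continuous.continuousAt.isBigO_one ℂ).mul (isBigO_expDividedDifference_one L w))
    simpa using h1.sub h2
  have hcard := (Multiset.card_le_card hroots).trans (card_roots' _)
  rw [Multiset.coe_card, hlen] at hcard
  exact absurd ((natDegree_lt_iff_degree_lt hD).2 hdeg) (not_lt.2 hcard)

end Interpolation

/-! ### Growth of the matrix exponential -/

section Matrix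

open Polynomial

theorem Matrix.norm_exp_smul_le {m : ℕ} (hm : 0 < m) (A : Matrix (Fin m) (Fin m) ℂ) {t : ℝ}
    (ht : 0 ≤ t) :
    ‖NormedSpace.exp ((t : ℂ) • A)‖ ≤ Real.exp (t * spectralAbscissa A) *
      ∑ j ∈ Finset.range m, (t * (2 * ‖A‖)) ^ j / (j.factorial : ℝ) := by
  have : Nonempty (Fin m) := ⟨⟨0, hm⟩⟩
  have : CompleteSpace (Matrix (Fin m) (Fin m) ℂ) := FiniteDimensional.complete ℂ _
  have : NormOneClass (Matrix (Fin m) (Fin m) ℂ) := inferInstance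
  set L := A.charpoly.roots.toList with hL
  have hsplit : A.charpoly.Splits := IsAlgClosed.splits _
  have hlen : L.length = m := by
    rw [hL, Multiset.length_toList, ← hsplit.natDegree_eq_card_roots,
      A.charpoly_natDegree_eq_dim, Fintype.card_fin]
  have hprod : (L.map fun v => X - C v).prod = A.charpoly := by
    rw [← Multiset.prod_coe, ← Multiset.map_coe, hL, Multiset.coe_toList]
    exact (hsplit.eq_prod_roots_of_monic A.charpoly_monic).symm
  have hspec : ∀ w ∈ L, w ∈ spectrum ℂ A := by
    intro w hw
    rw [hL, Multiset.mem_toList] at hw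
    exact Matrix.mem_spectrum_iff_isRoot_charpoly.2 (isRoot_of_mem_roots hw)
  have hbdd : BddAbove (Complex.re '' spectrum ℂ A) :=
    ((spectrum.isCompact A).image Complex.continuous_re).bddAbove
  have h := exp_eq_aeval_expNewtonPolynomial_add A t L
  rw [hprod, Matrix.aeval_self_charpoly, zero_mul, add_zero] at h
  have hle := norm_aeval_expNewtonPolynomial_le A (r := 2 * ‖A‖) (by positivity) ht L
    (fun w hw => ?_) fun w hw => le_csSup hbdd ⟨w, hspec w hw, rfl⟩
  · rwa [hlen, ← h] at hle
  -- The factor 2: eigenvalues satisfy |w| ≤ ‖A‖, so ‖A - w‖ ≤ 2‖A‖.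
  refine (norm_sub_le _ _).trans ?_
  rw [norm_algebraMap', two_mul]
  gcongr
  exact spectrum.norm_le_norm_of_mem (hspec w hw)

end Matrix

/-- The matrix norm is the operator norm induced by the Euclidean norm on `ℂᵐ`. -/
theorem corollary4 (m n : ℕ) (hm : 0 < m) (hn : 0 < n)
    (A : Matrix (Fin m) (Fin m) ℂ) (z : Fin n → ℂ) (p : Polynomial ℂ)
    (hp : IsInterpolationPolynomial Complex.exp z p) :
    ‖NormedSpace.exp A - Polynomial.aeval A p‖ ≤
      Real.exp (max (spectralAbscissa A) (maxRe z)) *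
        (‖Polynomial.aeval A (nodePolynomial z)‖ / (n.factorial : ℝ)) *
        ∑ j ∈ Finset.range m, (2 * ‖A‖) ^ j / (j.factorial : ℝ) := by
  have : CompleteSpace (Matrix (Fin m) (Fin m) ℂ) := FiniteDimensional.complete ℂ _
  set L := List.ofFn z with hL
  set γ := max (spectralAbscissa A) (maxRe z)
  set S := ∑ j ∈ Finset.range m, (2 * ‖A‖) ^ j / (j.factorial : ℝ)
  have hlen : L.length = n := by simp [hL]
  have hprod : (L.map fun v => Polynomial.X - Polynomial.C v).prod = nodePolynomial z := by
    rw [hL, List.map_ofFn, List.prod_ofFn]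
    rfl
  have hnodes : ∀ w ∈ L, w.re ≤ γ := by
    intro w hw
    obtain ⟨k, rfl⟩ := (List.mem_ofFn' z w).1 hw
    exact (le_ciSup (f := fun k => (z k).re) (Set.finite_range _).bddAbove k).trans
      (le_max_right _ _)
  -- Only t ≤ 1 is needed, and there the polynomial factor in t is at most its value `S` at t = 1.
  have hexp : ∀ t : ℝ, 0 ≤ t → t ≤ 1 →
      ‖NormedSpace.exp ((t : ℂ) • A)‖ ≤ S * Real.exp (t * γ) := by
    intro t ht0 ht1
    rw [mul_comm S]
    refine (Matrix.norm_exp_smul_le hm A ht0).trans (mul_le_mul ?_ ?_ ?_ (Real.exp_nonneg _))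
    · exact Real.exp_le_exp.2 (mul_le_mul_of_nonneg_left (le_max_left _ _) ht0)
    · refine Finset.sum_le_sum fun j _ => ?_
      have hA : t * (2 * ‖A‖) ≤ 2 * ‖A‖ := mul_le_of_le_one_left (by positivity) ht1
      exact div_le_div_of_nonneg_right (pow_le_pow_left₀ (by positivity) hA j) (by positivity)
    · exact Finset.sum_nonneg fun j _ => by positivity
  have hg := norm_expDividedDifference_le A hexp L hnodes zero_le_one le_rfl
  have h := exp_eq_aeval_expNewtonPolynomial_add A 1 L
  rw [Complex.ofReal_one, one_smul, hprod, ← hp.eq_expNewtonPolynomial] at h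
  rw [h, add_sub_cancel_left]
  refine (norm_mul_le _ _).trans ((mul_le_mul_of_nonneg_left hg (norm_nonneg _)).trans_eq ?_)
  rw [hlen, one_mul, one_pow]
  ring
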